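/- All graphs are finite and simple, and $\log$ is the natural logarithm. A total-coloring of a graph $G$ colors all its vertices and edges; it is a TMC-coloring if any two vertices of $G$ are connected by a path all of whose edges and internal vertices have the same color. For connected $G$, let $tmc(G)$ be the maximum number of colors used in a TMC-coloring of $G$; for disconnected $G$, let $tmc(G)=0$. Let $G(n,p)$ be the random graph on $n$ vertices in which each pair is an edge independently with probability $p$. For $p=p(n)\in[0,1]$, a property holds almost surely for $G(n,p)$ if its probability tends to $1$ as $n\to\infty$. A function $t(n)$ is called a sharp threshold function for a graph property $P$ if there are constants $C,c>0$ such that $G(n,p)$ almost surely satisfies $P$ for every $p=p(n)\in[0,1]$ with $p(n)\ge\min\{1,C\,t(n)\}$ for all sufficiently large $n$, and such that $c\,t(n)\in[0,1]$ for all sufficiently large $n$ and $G(n,c\,t(n))$ almost surely does not satisfy $P$. **Theorem.** Let $f$ be a real-valued function on the natural numbers with $1\le f(n)<\frac12 n(n-1)+n$ for all sufficiently large $n$. 1. If there is a constant $l>0$ such that $l\,n\log n\le f(n)$ for all sufficiently large $n$, then $$p=\frac{f(n)+n\log\log n}{n^2}$$ is a sharp threshold function for the property $tmc(G(n,p))\ge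 f(n)$. 2. If $f(n)=o(n\log n)$, then $$p=\frac{\log n}{n}$$ is a sharp threshold function for the property $tmc(G(n,p))\ge f(n)$. -/

import Mathlib

open Filter Topology Asymptotics

noncomputable section

namespace TMC

/-- A total coloring (`χ (.inl v)` is the color of the vertex `v`, `χ (.inr e)` that of the edge
`e`) is a TMC-coloring if any two vertices are joined by a path all of whose edges and internal
vertices have the same color. -/
def IsTMCColoring {V : Type*} (G : SimpleGraph V) (χ : V ⊕ G.edgeSet → ℕ) : Prop :=
  ∀ u v : V, ∃ p : G.Walk u v, p.IsPath ∧ ∃ c : ℕ,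
    (∀ (e : Sym2 V) (he : e ∈ p.edges), χ (.inr ⟨e, p.edges_subset_edgeSet he⟩) = c) ∧
    (∀ w ∈ p.support, w ≠ u → w ≠ v → χ (.inl w) = c)

open Classical in
/-- The total monochromatic connection number of a finite graph: the maximum number of colors used
in a TMC-coloring if the graph is connected, and `0` otherwise. -/
def tmc {V : Type*} (G : SimpleGraph V) : ℕ :=
  if G.Connected then
    sSup {k : ℕ | ∃ χ : V ⊕ G.edgeSet → ℕ, IsTMCColoring G χ ∧ (Set.range χ).ncard = k}
  else 0

/-- `G(n, p(n))` satisfies the graph property `P` with probability tending to `1`. -/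
def AlmostSurely (P : ∀ n : ℕ, SimpleGraph (Fin n) → Prop) (p : ℕ → unitInterval) : Prop :=
  Tendsto (fun n => SimpleGraph.binomialRandom (Fin n) (p n) {G | P n G}) atTop (𝓝 1)

/-- `t` is a sharp threshold function for `P`: there are constants `C, c > 0` such that
`G(n, p)` almost surely satisfies `P` for every `p = p(n) ≥ C t(n)`, and `G(n, c t(n))` almost
surely does not satisfy `P`. Where `C t(n) > 1`, the bound on `p(n)` is read as `p(n) = 1`; and
`c t(n)` has to be a probability for all large `n`. -/
def IsSharpThreshold (t : ℕ → ℝ) (P : ∀ n : ℕ, SimpleGraph (Fin n) → Prop) : Prop :=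
  ∃ C c : ℝ, 0 < C ∧ 0 < c ∧
    (∀ p : ℕ → unitInterval, (∀ᶠ n in atTop, min 1 (C * t n) ≤ (p n : ℝ)) →
      AlmostSurely P p) ∧
    (∃ q : ℕ → unitInterval, (∀ᶠ n in atTop, (q n : ℝ) = c * t n) ∧
      AlmostSurely (fun n G => ¬ P n G) q)

end TMC

end

/-!
A connected graph with `n` vertices and `m` edges satisfies `m - n + 2 ≤ tmc G ≤ n + m`: for the
lower bound, give one color to all vertices and to the edges of a spanning tree, and a new color to
each other edge. As `tmc` vanishes on disconnected graphs, `f n ≤ tmc G` amounts, up to constants,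
to `G` being connected with at least `f n` edges. The thresholds `log n / n` and `f n / n ^ 2` of
these two conditions add up to `(f n + n * log n) / n ^ 2`, which is a sharp threshold function
whatever the growth of `f`; in each of the two regimes of the theorem it has the order of the given
function.
The edge count is concentrated, and isolated vertices exist below `log n / n`, by the second moment
method; above `log n / n`, a union bound over all cuts yields connectivity.
-/

namespace TMC

open MeasureTheory ProbabilityTheory SimpleGraph

section Coloring

variable {V : Type*} {G : SimpleGraph V}

theorem isTMCColoring_of_preconnected_le {T : SimpleGraph V} (hTG : T ≤ G) (hT : T.Preconnected)
    {χ : V ⊕ G.edgeSet → ℕ} {c : ℕ} (hvertex : ∀ v, χ (.inl v) = c)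
    (hedge : ∀ e (he : e ∈ T.edgeSet), χ (.inr ⟨e, edgeSet_mono hTG he⟩) = c) :
    IsTMCColoring G χ := by
  intro u v
  obtain ⟨p, hp⟩ := (hT u v).exists_isPath
  refine ⟨p.mapLe hTG, hp.mapLe hTG, c, fun e he => ?_, fun w _ _ _ => hvertex w⟩
  exact hedge e (p.edges_subset_edgeSet (by simpa using he))

theorem isTMCColoring_top (χ : V ⊕ (⊤ : SimpleGraph V).edgeSet → ℕ) : IsTMCColoring ⊤ χ := by
  intro u v
  by_cases huv : u = v
  · subst huv
    exact ⟨.nil, .nil, 0, by simp, by simp⟩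
  · have hadj : (⊤ : SimpleGraph V).Adj u v := huv
    refine ⟨hadj.toWalk, .of_adj hadj, χ (.inr ⟨s(u, v), hadj⟩), fun e he => ?_, fun w hw => ?_⟩
    · obtain rfl : e = s(u, v) := by simpa using he
      rfl
    · have hends : w = u ∨ w = v := by simpa using hw
      tauto

variable [Finite V]

theorem ncard_range_le (χ : V ⊕ G.edgeSet → ℕ) :
    (Set.range χ).ncard ≤ Nat.card V + G.edgeSet.ncard :=
  calc (Set.range χ).ncard = (χ '' Set.univ).ncard := by rw [Set.image_univ]
    _ ≤ (Set.univ : Set (V ⊕ G.edgeSet)).ncard := Set.ncard_image_le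
    _ = Nat.card V + G.edgeSet.ncard := by
        rw [Set.ncard_univ, Nat.card_sum, Nat.card_coe_set_eq]

theorem tmc_le (G : SimpleGraph V) : tmc G ≤ Nat.card V + G.edgeSet.ncard := by
  unfold tmc
  split_ifs
  · refine csSup_le' ?_
    rintro k ⟨χ, -, rfl⟩
    exact ncard_range_le χ
  · exact Nat.zero_le _

theorem tmc_eq_zero_of_not_connected {V : Type*} {G : SimpleGraph V} (hG : ¬ G.Connected) :
    tmc G = 0 :=
  if_neg hG

theorem IsTMCColoring.ncard_range_le_tmc (hG : G.Connected) {χ : V ⊕ G.edgeSet → ℕ}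
    (hχ : IsTMCColoring G χ) : (Set.range χ).ncard ≤ tmc G := by
  rw [tmc, if_pos hG]
  refine le_csSup ⟨Nat.card V + G.edgeSet.ncard, ?_⟩ ⟨χ, hχ, rfl⟩
  rintro k ⟨χ', -, rfl⟩
  exact ncard_range_le χ'

theorem tmc_top [Nonempty V] :
    tmc (⊤ : SimpleGraph V) = Nat.card V + (⊤ : SimpleGraph V).edgeSet.ncard := by
  refine le_antisymm (tmc_le ⊤) ?_
  obtain ⟨χ, hχ⟩ := Countable.exists_injective_nat (V ⊕ (⊤ : SimpleGraph V).edgeSet)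
  have h := (isTMCColoring_top χ).ncard_range_le_tmc connected_top
  rwa [← Set.image_univ, Set.ncard_image_of_injective _ hχ, Set.ncard_univ, Nat.card_sum,
    Nat.card_coe_set_eq] at h

theorem ncard_edgeSet_add_one_of_isTree {T : SimpleGraph V} (hT : T.IsTree) :
    T.edgeSet.ncard + 1 = Nat.card V := by
  classical
  cases nonempty_fintype V
  have h := hT.card_edgeFinset
  rwa [← Nat.card_eq_fintype_card, ← Set.ncard_coe_finset, coe_edgeFinset] at h

theorem ncard_edgeSet_add_two_le_tmc_add_card (hG : G.Connected) :
    G.edgeSet.ncard + 2 ≤ tmc G + Nat.card V := by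
  classical
  obtain ⟨T, hTG, hT⟩ := hG.exists_isTree_le
  obtain ⟨g, hg⟩ := Countable.exists_injective_nat (Sym2 V)
  let χ : V ⊕ G.edgeSet → ℕ :=
    Sum.elim (fun _ => 0) fun e => if e.1 ∈ T.edgeSet then 0 else g e.1 + 1
  have hχ : IsTMCColoring G χ :=
    isTMCColoring_of_preconnected_le hTG hT.connected.preconnected (fun _ => rfl)
      fun e he => if_pos he
  have hcolors : insert 0 ((fun e => g e + 1) '' (G.edgeSet \ T.edgeSet)) ⊆ Set.range χ := by
    obtain ⟨v⟩ := hG.nonempty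
    rintro _ (rfl | ⟨e, ⟨heG, heT⟩, rfl⟩)
    · exact ⟨.inl v, rfl⟩
    · exact ⟨.inr ⟨e, heG⟩, if_neg heT⟩
  have hcount : (G.edgeSet \ T.edgeSet).ncard + 1 ≤ tmc G := by
    refine le_trans (le_of_eq ?_)
      ((Set.ncard_le_ncard hcolors (Set.finite_range χ)).trans (hχ.ncard_range_le_tmc hG))
    rw [Set.ncard_insert_of_notMem (by simp) (Set.toFinite _),
      Set.ncard_image_of_injective _ fun a b h => hg (Nat.succ_injective h)]
  rw [Set.ncard_sdiff (edgeSet_mono hTG) (Set.toFinite _)] at hcount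
  have htree := ncard_edgeSet_add_one_of_isTree hT
  omega

end Coloring

theorem exists_cut_of_not_connected {V : Type*} [Fintype V] [Nonempty V] {G : SimpleGraph V}
    (hG : ¬ G.Connected) :
    ∃ S : Finset V, S.Nonempty ∧ 2 * S.card ≤ Fintype.card V ∧
      ∀ u ∈ S, ∀ v ∉ S, ¬ G.Adj u v := by
  classical
  obtain ⟨a, b, hab⟩ : ∃ a b, ¬ G.Reachable a b := by
    by_contra! h
    exact hG ⟨h⟩
  let A : Finset V := {v | G.Reachable a v}
  have hcut : ∀ u ∈ A, ∀ v ∉ A, ¬ G.Adj u v := by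
    intro u hu v hv huv
    simp only [A, Finset.mem_filter_univ] at hu hv
    exact hv (hu.trans huv.reachable)
  have hcard := Finset.card_add_card_compl A
  by_cases h : 2 * A.card ≤ Fintype.card V
  · exact ⟨A, ⟨a, by simp [A]⟩, h, hcut⟩
  · refine ⟨Aᶜ, ⟨b, by simp [A, hab]⟩, by omega, fun u hu v hv huv => ?_⟩
    exact hcut v (by simpa using hv) u (by simpa using hu) huv.symm

section SecondMoment

variable {Ω ι : Type*} {A : ι → Set Ω} {s : Finset ι}

/-- The number of events `A i`, `i ∈ s`, that occur; the random variable to which the second moment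
method is applied. It is real-valued so that it has an expectation and a variance. -/
noncomputable def eventCount (A : ι → Set Ω) (s : Finset ι) : Ω → ℝ :=
  ∑ i ∈ s, (A i).indicator 1

theorem eventCount_eq_zero {ω : Ω} (h : ∀ i ∈ s, ω ∉ A i) : eventCount A s ω = 0 := by
  rw [eventCount, Finset.sum_apply]
  exact Finset.sum_eq_zero fun i hi => Set.indicator_of_notMem (h i hi) _

variable [MeasurableSpace Ω] {μ : Measure Ω} [IsProbabilityMeasure μ] {a δ : ℝ}

theorem memLp_indicator_one {B : Set Ω} (hB : MeasurableSet B) :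
    MemLp (B.indicator (1 : Ω → ℝ)) 2 μ :=
  memLp_indicator_const 2 hB 1 (Or.inr (measure_ne_top μ B))

theorem memLp_eventCount (hA : ∀ i ∈ s, MeasurableSet (A i)) : MemLp (eventCount A s) 2 μ :=
  memLp_finsetSum' s fun i hi => memLp_indicator_one (hA i hi)

theorem integral_eventCount (hA : ∀ i ∈ s, MeasurableSet (A i)) :
    μ[eventCount A s] = ∑ i ∈ s, μ.real (A i) := by
  simp only [eventCount, Finset.sum_apply]
  rw [integral_finsetSum _ fun i hi => (memLp_indicator_one (hA i hi)).integrable one_le_two]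
  exact Finset.sum_congr rfl fun i hi => integral_indicator_one (hA i hi)

theorem covariance_indicator_one {B C : Set Ω} (hB : MeasurableSet B) (hC : MeasurableSet C) :
    cov[B.indicator 1, C.indicator 1; μ] = μ.real (B ∩ C) - μ.real B * μ.real C := by
  rw [covariance_eq_sub (memLp_indicator_one hB) (memLp_indicator_one hC),
    ← Set.inter_indicator_one, integral_indicator_one hB, integral_indicator_one hC,
    integral_indicator_one (hB.inter hC)]

theorem variance_eventCount_le (hA : ∀ i ∈ s, MeasurableSet (A i))
    (ha : ∑ i ∈ s, μ.real (A i) = a) (hδ : 0 ≤ δ)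
    (hpair : ∀ i ∈ s, ∀ j ∈ s, i ≠ j →
      μ.real (A i ∩ A j) ≤ (1 + δ) * (μ.real (A i) * μ.real (A j))) :
    Var[eventCount A s; μ] ≤ a + δ * a ^ 2 := by
  classical
  have hcov : ∀ i ∈ s, ∀ j ∈ s, cov[(A i).indicator 1, (A j).indicator 1; μ] ≤
      (if i = j then μ.real (A i) else 0) + δ * (μ.real (A i) * μ.real (A j)) := by
    intro i hi j hj
    rw [covariance_indicator_one (hA i hi) (hA j hj)]
    split_ifs with hij
    · subst hij
      rw [Set.inter_self]
      nlinarith [mul_nonneg hδ (mul_self_nonneg (μ.real (A i))), mul_self_nonneg (μ.real (A i))]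
    · linarith [hpair i hi j hj hij]
  rw [eventCount, variance_sum' fun i hi => memLp_indicator_one (hA i hi)]
  calc ∑ i ∈ s, ∑ j ∈ s, cov[(A i).indicator 1, (A j).indicator 1; μ]
      ≤ ∑ i ∈ s, ∑ j ∈ s,
          ((if i = j then μ.real (A i) else 0) + δ * (μ.real (A i) * μ.real (A j))) :=
        Finset.sum_le_sum fun i hi => Finset.sum_le_sum fun j hj => hcov i hi j hj
    _ = ∑ i ∈ s, μ.real (A i) + δ * ((∑ i ∈ s, μ.real (A i)) * ∑ j ∈ s, μ.real (A j)) := by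
        rw [Finset.sum_mul_sum]
        simp only [Finset.sum_add_distrib, Finset.mul_sum, Finset.sum_ite_eq, Finset.sum_ite_mem,
          Finset.inter_self]
    _ = a + δ * a ^ 2 := by rw [ha, sq]

theorem measureReal_le_abs_eventCount_sub_le (hA : ∀ i ∈ s, MeasurableSet (A i))
    (ha : ∑ i ∈ s, μ.real (A i) = a) (hδ : 0 ≤ δ)
    (hpair : ∀ i ∈ s, ∀ j ∈ s, i ≠ j →
      μ.real (A i ∩ A j) ≤ (1 + δ) * (μ.real (A i) * μ.real (A j))) {ε : ℝ} (hε : 0 < ε) :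
    μ.real {ω | ε ≤ |eventCount A s ω - a|} ≤ (a + δ * a ^ 2) / ε ^ 2 := by
  have hchebyshev := meas_ge_le_variance_div_sq (memLp_eventCount (μ := μ) hA) hε
  rw [integral_eventCount hA, ha] at hchebyshev
  calc μ.real {ω | ε ≤ |eventCount A s ω - a|}
      ≤ Var[eventCount A s; μ] / ε ^ 2 :=
        ENNReal.toReal_le_of_le_ofReal (div_nonneg (variance_nonneg _ _) (sq_nonneg ε)) hchebyshev
    _ ≤ (a + δ * a ^ 2) / ε ^ 2 := by
        gcongr
        exact variance_eventCount_le hA ha hδ hpair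

theorem measureReal_forall_notMem_le (hA : ∀ i ∈ s, MeasurableSet (A i))
    (ha : ∑ i ∈ s, μ.real (A i) = a) (hδ : 0 ≤ δ)
    (hpair : ∀ i ∈ s, ∀ j ∈ s, i ≠ j →
      μ.real (A i ∩ A j) ≤ (1 + δ) * (μ.real (A i) * μ.real (A j))) (ha0 : 0 < a) :
    μ.real {ω | ∀ i ∈ s, ω ∉ A i} ≤ 1 / a + δ :=
  calc μ.real {ω | ∀ i ∈ s, ω ∉ A i} ≤ μ.real {ω | a ≤ |eventCount A s ω - a|} :=
        measureReal_mono fun ω hω => by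
          simp [eventCount_eq_zero hω, abs_of_pos ha0]
    _ ≤ (a + δ * a ^ 2) / a ^ 2 := measureReal_le_abs_eventCount_sub_le hA ha hδ hpair ha0
    _ = 1 / a + δ := by field_simp

end SecondMoment

section BinomialRandomGraph

variable {V : Type*}

theorem measurableSet_setOf_subset_disjoint_edgeSet (s t : Finset (Sym2 V)) :
    MeasurableSet {G : SimpleGraph V | ↑s ⊆ G.edgeSet ∧ Disjoint ↑t G.edgeSet} := by
  have hmem : ∀ e : Sym2 V, MeasurableSet {G : SimpleGraph V | e ∈ G.edgeSet} := fun e =>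
    measurableSet_setOfPred.2 ((measurable_set_mem e).comp measurable_edgeSet)
  simp only [Set.subset_def, Set.disjoint_left, Finset.mem_coe, Set.ofPred_and, Set.ofPred_forall]
  exact (s.measurableSet_biInter fun e _ => hmem e).inter
    (t.measurableSet_biInter fun e _ => (hmem e).compl)

theorem binomialRandom_real_subset_disjoint_edgeSet [Countable V] (p : unitInterval)
    {s t : Finset (Sym2 V)} (hst : Disjoint s t) (hs : ∀ e ∈ s, ¬ e.IsDiag)
    (ht : ∀ e ∈ t, ¬ e.IsDiag) :
    G(V, p).real {G | ↑s ⊆ G.edgeSet ∧ Disjoint ↑t G.edgeSet} =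
      (p : ℝ) ^ s.card * (1 - p : ℝ) ^ t.card := by
  classical
  have hpre : (fun x : Sym2 V → Prop => {e | x e}) ⁻¹' (fromEdgeSet ⁻¹'
      {G : SimpleGraph V | ↑s ⊆ G.edgeSet ∧ Disjoint ↑t G.edgeSet}) =
        Set.pi (s ∪ t : Finset (Sym2 V)) fun e => {e ∈ s} := by
    ext x
    simp only [Set.mem_preimage, Set.mem_ofPred_eq, edgeSet_fromEdgeSet, Set.subset_def,
      Set.disjoint_left, Finset.mem_coe, Set.mem_pi, Finset.mem_union, Set.mem_singleton_iff,
      Set.mem_sdiff, Sym2.mem_diagSet]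
    rw [Finset.disjoint_left] at hst
    grind
  have hmeasure : G(V, p) {G | ↑s ⊆ G.edgeSet ∧ Disjoint ↑t G.edgeSet} =
      (unitInterval.toNNReal p : ENNReal) ^ s.card *
        (unitInterval.toNNReal (unitInterval.symm p) : ENNReal) ^ t.card := by
    rw [binomialRandom_eq_map, Measure.map_apply measurable_fromEdgeSet
      (measurableSet_setOf_subset_disjoint_edgeSet s t), setBernoulli_apply', hpre,
      Measure.infinitePi_pi _ fun _ _ => .of_discrete, Finset.prod_union hst]
    congr 1
    · refine Finset.prod_eq_pow_card fun e he => ?_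
      simp [hs e he, he]
    · refine Finset.prod_eq_pow_card fun e he => ?_
      simp [ht e he, Finset.disjoint_right.1 hst he]
  simp [measureReal_def, hmeasure]

theorem binomialRandom_real_subset_edgeSet [Countable V] (p : unitInterval) {s : Finset (Sym2 V)}
    (hs : ∀ e ∈ s, ¬ e.IsDiag) : G(V, p).real {G | ↑s ⊆ G.edgeSet} = (p : ℝ) ^ s.card := by
  simpa using binomialRandom_real_subset_disjoint_edgeSet p (Finset.disjoint_empty_right s) hs
    (by simp)

theorem binomialRandom_real_disjoint_edgeSet [Countable V] (p : unitInterval)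
    {t : Finset (Sym2 V)} (ht : ∀ e ∈ t, ¬ e.IsDiag) :
    G(V, p).real {G | Disjoint ↑t G.edgeSet} = (1 - p : ℝ) ^ t.card := by
  simpa using binomialRandom_real_subset_disjoint_edgeSet p (Finset.disjoint_empty_left t)
    (by simp) ht

theorem binomialRandom_real_disjoint_edgeSet_inter_mul [Countable V] [DecidableEq V]
    (p : unitInterval) {s t : Finset (Sym2 V)} (hs : ∀ e ∈ s, ¬ e.IsDiag)
    (ht : ∀ e ∈ t, ¬ e.IsDiag) :
    G(V, p).real ({G | Disjoint ↑s G.edgeSet} ∩ {G | Disjoint ↑t G.edgeSet}) *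
        (1 - p : ℝ) ^ (s ∩ t).card =
      G(V, p).real {G | Disjoint ↑s G.edgeSet} * G(V, p).real {G | Disjoint ↑t G.edgeSet} := by
  have hunion : {G : SimpleGraph V | Disjoint ↑s G.edgeSet} ∩ {G | Disjoint ↑t G.edgeSet} =
      {G | Disjoint ↑(s ∪ t) G.edgeSet} := by
    ext G
    simp only [Set.mem_inter_iff, Set.mem_ofPred_eq, Finset.coe_union, Set.disjoint_union_left]
  have hst : ∀ e ∈ s ∪ t, ¬ e.IsDiag := fun e he => (Finset.mem_union.1 he).elim (hs e) (ht e)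
  rw [hunion, binomialRandom_real_disjoint_edgeSet p hst, binomialRandom_real_disjoint_edgeSet p hs,
    binomialRandom_real_disjoint_edgeSet p ht, ← pow_add, ← pow_add,
    Finset.card_union_add_card_inter]

instance instDiscreteMeasurableSpaceSimpleGraph [Finite V] :
    DiscreteMeasurableSpace (SimpleGraph V) where
  forall_measurableSet S :=
    measurableEmbedding_edgeSet.measurableSet_image.1 (Set.toFinite (edgeSet '' S)).measurableSet

variable [Fintype V]

theorem eventCount_mem_edgeSet [DecidableEq V] (G : SimpleGraph V) :
    eventCount (fun e => {G : SimpleGraph V | e ∈ G.edgeSet}) (⊤ : SimpleGraph V).edgeFinset G =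
      G.edgeSet.ncard := by
  classical
  have hfilter : (⊤ : SimpleGraph V).edgeFinset.filter (· ∈ G.edgeSet) = G.edgeFinset := by
    ext e
    simpa using fun he => edgeSet_mono le_top he
  rw [← coe_edgeFinset G, Set.ncard_coe_finset, ← hfilter, Finset.card_filter, eventCount,
    Finset.sum_apply, Nat.cast_sum]
  exact Finset.sum_congr rfl fun e _ => by simp [Set.indicator_apply]

theorem ncard_edgeSet_top : (⊤ : SimpleGraph V).edgeSet.ncard = (Fintype.card V).choose 2 := by
  classical
  rw [← coe_edgeFinset, Set.ncard_coe_finset, card_edgeFinset_top_eq_card_choose_two]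

theorem binomialRandom_real_le_abs_ncard_edgeSet_sub (p : unitInterval) {ε : ℝ} (hε : 0 < ε) :
    G(V, p).real {G | ε ≤ |(G.edgeSet.ncard : ℝ) - (Fintype.card V).choose 2 * p|} ≤
      (Fintype.card V).choose 2 * p / ε ^ 2 := by
  classical
  have hdiag : ∀ e ∈ (⊤ : SimpleGraph V).edgeFinset, ¬ e.IsDiag :=
    fun e he => not_isDiag_of_mem_edgeFinset he
  have hedge : ∀ e ∈ (⊤ : SimpleGraph V).edgeFinset, G(V, p).real {G | e ∈ G.edgeSet} = p :=
    fun e he => by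
      simpa using binomialRandom_real_subset_edgeSet p (s := {e}) (by simpa using hdiag e he)
  have hpair : ∀ e ∈ (⊤ : SimpleGraph V).edgeFinset, ∀ e' ∈ (⊤ : SimpleGraph V).edgeFinset,
      e ≠ e' → G(V, p).real ({G | e ∈ G.edgeSet} ∩ {G | e' ∈ G.edgeSet}) = p * p := by
    intro e he e' he' hne
    have h := binomialRandom_real_subset_edgeSet p (s := {e, e'})
      (by simpa using ⟨hdiag e he, hdiag e' he'⟩)
    rw [Finset.card_pair hne, Finset.coe_pair, sq] at h
    simpa only [Set.pair_subset_iff, Set.ofPred_and] using h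
  have hmean : ∑ e ∈ (⊤ : SimpleGraph V).edgeFinset, G(V, p).real {G | e ∈ G.edgeSet} =
      (Fintype.card V).choose 2 * p := by
    rw [Finset.sum_congr rfl hedge, Finset.sum_const, card_edgeFinset_top_eq_card_choose_two,
      nsmul_eq_mul]
  have h := measureReal_le_abs_eventCount_sub_le (fun e _ => .of_discrete) hmean le_rfl
    (fun e he e' he' hne => by rw [hpair e he e' he' hne, hedge e he, hedge e' he']; simp) hε
  simpa only [eventCount_mem_edgeSet, zero_mul, add_zero] using h

theorem binomialRandom_real_forall_not_adj (p : unitInterval) (S : Finset V) :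
    G(V, p).real {G | ∀ u ∈ S, ∀ v ∉ S, ¬ G.Adj u v} =
      (1 - p : ℝ) ^ (S.card * (Fintype.card V - S.card)) := by
  classical
  have hinj : Set.InjOn (fun x : V × V => s(x.1, x.2)) (S ×ˢ Sᶜ : Finset (V × V)) := by
    rintro ⟨a, b⟩ hab ⟨c, d⟩ hcd h
    simp only [Finset.coe_product, Set.mem_prod, Finset.mem_coe, Finset.mem_compl] at hab hcd
    rcases Sym2.eq_iff.1 h with ⟨rfl, rfl⟩ | ⟨rfl, rfl⟩
    · rfl
    · exact absurd hab.1 hcd.2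
  rw [← Finset.card_compl, ← Finset.card_product, ← Finset.card_image_of_injOn hinj,
    ← binomialRandom_real_disjoint_edgeSet]
  · congr 1
    ext G
    simp only [Set.mem_ofPred_eq, Set.disjoint_left, Finset.mem_coe, Finset.forall_mem_image,
      Finset.mem_product, Finset.mem_compl, mem_edgeSet, Prod.forall]
    grind
  · simp only [Finset.forall_mem_image, Finset.mem_product, Finset.mem_compl, Sym2.mk_isDiag_iff,
      Prod.forall]
    rintro a b ⟨ha, hb⟩ rfl
    exact hb ha

theorem binomialRandom_real_forall_not_adj_le (p : unitInterval) {S : Finset V}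
    (hS : 2 * S.card ≤ Fintype.card V) :
    G(V, p).real {G | ∀ u ∈ S, ∀ v ∉ S, ¬ G.Adj u v} ≤
      Real.exp (-(p * Fintype.card V / 2)) ^ S.card := by
  have hhalf : (Fintype.card V : ℝ) / 2 ≤ (Fintype.card V - S.card : ℕ) := by
    rw [div_le_iff₀ two_pos]
    exact_mod_cast (by omega : Fintype.card V ≤ (Fintype.card V - S.card) * 2)
  have hp1 : (0 : ℝ) ≤ 1 - p := sub_nonneg.2 p.2.2
  rw [binomialRandom_real_forall_not_adj, mul_comm, pow_mul]
  gcongr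
  calc (1 - p : ℝ) ^ (Fintype.card V - S.card)
      ≤ Real.exp (-p) ^ (Fintype.card V - S.card) := by
        gcongr
        exact Real.one_sub_le_exp_neg p
    _ = Real.exp ((Fintype.card V - S.card : ℕ) * -p) := (Real.exp_nat_mul _ _).symm
    _ ≤ Real.exp (-(p * Fintype.card V / 2)) := by
        rw [Real.exp_le_exp]
        nlinarith [p.2.1]

theorem sum_pow_card_erase_empty [DecidableEq V] (x : ℝ) :
    ∑ S ∈ (Finset.univ : Finset (Finset V)).erase ∅, x ^ S.card =
      (1 + x) ^ Fintype.card V - 1 := by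
  have h := Fintype.sum_pow_mul_eq_add_pow V x 1
  simp only [one_pow, mul_one] at h
  rw [add_comm 1 x, ← h, ← Finset.add_sum_erase _ _ (Finset.mem_univ (∅ : Finset V)),
    Finset.card_empty, pow_zero, add_sub_cancel_left]

theorem binomialRandom_real_not_connected_le [Nonempty V] (p : unitInterval) :
    G(V, p).real {G | ¬ G.Connected} ≤
      Real.exp (Fintype.card V * Real.exp (-(p * Fintype.card V / 2))) - 1 := by
  classical
  set x := Real.exp (-(p * Fintype.card V / 2 : ℝ))
  let F : Finset (Finset V) := {S | S.Nonempty ∧ 2 * S.card ≤ Fintype.card V}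
  have hcover : {G : SimpleGraph V | ¬ G.Connected} ⊆
      ⋃ S ∈ F, {G | ∀ u ∈ S, ∀ v ∉ S, ¬ G.Adj u v} := by
    intro G hG
    obtain ⟨S, hne, hcard, hcut⟩ := exists_cut_of_not_connected hG
    exact Set.mem_biUnion (Finset.mem_filter_univ S |>.2 ⟨hne, hcard⟩) hcut
  have hF : F ⊆ (Finset.univ : Finset (Finset V)).erase ∅ := fun S hS =>
    Finset.mem_erase.2 ⟨(Finset.mem_filter.1 hS).2.1.ne_empty, Finset.mem_univ S⟩
  calc G(V, p).real {G | ¬ G.Connected}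
      ≤ ∑ S ∈ F, G(V, p).real {G | ∀ u ∈ S, ∀ v ∉ S, ¬ G.Adj u v} :=
        (measureReal_mono hcover (measure_ne_top _ _)).trans (measureReal_biUnion_finset_le _ _)
    _ ≤ ∑ S ∈ F, x ^ S.card := Finset.sum_le_sum fun S hS =>
        binomialRandom_real_forall_not_adj_le p (Finset.mem_filter.1 hS).2.2
    _ ≤ ∑ S ∈ (Finset.univ : Finset (Finset V)).erase ∅, x ^ S.card :=
        Finset.sum_le_sum_of_subset_of_nonneg hF fun _ _ _ => by positivity
    _ = (1 + x) ^ Fintype.card V - 1 := sum_pow_card_erase_empty x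
    _ ≤ Real.exp (Fintype.card V * x) - 1 := by
        rw [Real.exp_nat_mul, add_comm]
        gcongr
        exact Real.add_one_le_exp x

theorem isIsolated_iff_disjoint_edgeSet [DecidableEq V] {G : SimpleGraph V} {v : V} :
    G.IsIsolated v ↔ Disjoint ↑((⊤ : SimpleGraph V).incidenceFinset v) G.edgeSet := by
  simp only [Set.disjoint_left, Finset.mem_coe, mem_incidenceFinset]
  constructor
  · rintro h e ⟨-, hv⟩ he
    obtain ⟨w, rfl⟩ := Sym2.mem_iff_exists.1 hv
    exact h w he
  · intro h w hw
    exact h ⟨hw.ne, Sym2.mem_mk_left v w⟩ hw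

theorem not_isDiag_of_mem_incidenceFinset [DecidableEq V] {v : V} :
    ∀ e ∈ (⊤ : SimpleGraph V).incidenceFinset v, ¬ e.IsDiag := fun _ he =>
  (⊤ : SimpleGraph V).not_isDiag_of_mem_edgeSet ((mem_incidenceFinset ..).1 he).1

theorem binomialRandom_real_isIsolated (p : unitInterval) (v : V) :
    G(V, p).real {G | G.IsIsolated v} = (1 - p : ℝ) ^ (Fintype.card V - 1) := by
  classical
  simp only [isIsolated_iff_disjoint_edgeSet]
  rw [binomialRandom_real_disjoint_edgeSet p not_isDiag_of_mem_incidenceFinset,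
    card_incidenceFinset_eq_degree, complete_graph_degree]

theorem binomialRandom_real_isIsolated_inter_mul {V : Type*} [Finite V] (p : unitInterval)
    {u v : V} (huv : u ≠ v) :
    G(V, p).real ({G | G.IsIsolated u} ∩ {G | G.IsIsolated v}) * (1 - p) =
      G(V, p).real {G | G.IsIsolated u} * G(V, p).real {G | G.IsIsolated v} := by
  classical
  cases nonempty_fintype V
  have hcommon : (⊤ : SimpleGraph V).incidenceFinset u ∩ (⊤ : SimpleGraph V).incidenceFinset v =
      {s(u, v)} := by
    have hadj : (⊤ : SimpleGraph V).Adj u v := huv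
    rw [← Finset.coe_inj]
    push_cast
    exact incidenceSet_inter_incidenceSet_of_adj _ hadj
  have h := binomialRandom_real_disjoint_edgeSet_inter_mul p
    (not_isDiag_of_mem_incidenceFinset (v := u)) (not_isDiag_of_mem_incidenceFinset (v := v))
  rw [hcommon, Finset.card_singleton, pow_one] at h
  simpa only [isIsolated_iff_disjoint_edgeSet] using h

theorem binomialRandom_real_connected_le [Nontrivial V] (p : unitInterval) (hp : (p : ℝ) < 1) :
    G(V, p).real {G | G.Connected} ≤
      1 / (Fintype.card V * (1 - p : ℝ) ^ (Fintype.card V - 1)) + p / (1 - p) := by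
  have hp1 : (0 : ℝ) < 1 - p := sub_pos.2 hp
  have hmean : ∑ v : V, G(V, p).real {G | G.IsIsolated v} =
      Fintype.card V * (1 - p : ℝ) ^ (Fintype.card V - 1) := by
    simp [binomialRandom_real_isIsolated]
  have hpair : ∀ u ∈ (Finset.univ : Finset V), ∀ v ∈ Finset.univ, u ≠ v →
      G(V, p).real ({G | G.IsIsolated u} ∩ {G | G.IsIsolated v}) ≤
        (1 + p / (1 - p)) *
          (G(V, p).real {G | G.IsIsolated u} * G(V, p).real {G | G.IsIsolated v}) := by
    intro u _ v _ huv
    rw [← binomialRandom_real_isIsolated_inter_mul p huv]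
    refine le_of_eq ?_
    field_simp
    ring
  refine (measureReal_mono fun G hG => ?_).trans
    (measureReal_forall_notMem_le (fun v _ => .of_discrete) hmean (div_nonneg p.2.1 hp1.le)
      hpair (by positivity))
  intro v _ hv
  obtain ⟨w, hw⟩ := (hG : G.Connected).preconnected.exists_adj_of_nontrivial v
  exact hv w hw

end BinomialRandomGraph

section AlmostSurely

variable {P Q : ∀ n : ℕ, SimpleGraph (Fin n) → Prop} {p : ℕ → unitInterval} {ε : ℕ → ℝ}

theorem almostSurely_iff_tendsto_real_not :
    AlmostSurely P p ↔ Tendsto (fun n => G(Fin n, p n).real {G | ¬ P n G}) atTop (𝓝 0) := by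
  have hcompl : ∀ n, G(Fin n, p n).real {G | ¬ P n G} = 1 - G(Fin n, p n).real {G | P n G} :=
    fun n => probReal_compl_eq_one_sub (s := {G | P n G}) .of_discrete
  have hreal : AlmostSurely P p ↔
      Tendsto (fun n => G(Fin n, p n).real {G | P n G}) atTop (𝓝 1) :=
    (ENNReal.tendsto_toReal_iff (fun _ => measure_ne_top _ _) ENNReal.one_ne_top).symm
  rw [hreal]
  simp only [hcompl]
  exact ⟨fun h => by simpa using h.const_sub 1, fun h => by simpa using h.const_sub 1⟩

theorem almostSurely_of_eventually_real_not_le (hε : Tendsto ε atTop (𝓝 0))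
    (h : ∀ᶠ n in atTop, G(Fin n, p n).real {G | ¬ P n G} ≤ ε n) : AlmostSurely P p :=
  almostSurely_iff_tendsto_real_not.2 <| tendsto_of_tendsto_of_tendsto_of_le_of_le'
    tendsto_const_nhds hε (.of_forall fun _ => measureReal_nonneg) h

theorem almostSurely_imp_of_eventually_real_not_le {c : ℕ → Prop} (hε : Tendsto ε atTop (𝓝 0))
    (h : ∀ᶠ n in atTop, c n → G(Fin n, p n).real {G | ¬ P n G} ≤ ε n) :
    AlmostSurely (fun n G => c n → P n G) p := by
  refine almostSurely_of_eventually_real_not_le (by simpa using hε.abs) ?_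
  filter_upwards [h] with n hn
  by_cases hc : c n
  · simpa only [hc, forall_const] using (hn hc).trans (le_abs_self (ε n))
  · simp [hc]

theorem AlmostSurely.mono (hP : AlmostSurely P p) (h : ∀ᶠ n in atTop, ∀ G, P n G → Q n G) :
    AlmostSurely Q p := by
  refine almostSurely_of_eventually_real_not_le (almostSurely_iff_tendsto_real_not.1 hP) ?_
  filter_upwards [h] with n hn
  exact measureReal_mono (fun G hG hPG => hG (hn G hPG)) (measure_ne_top _ _)

theorem AlmostSurely.and (hP : AlmostSurely P p) (hQ : AlmostSurely Q p) :
    AlmostSurely (fun n G => P n G ∧ Q n G) p := by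
  rw [almostSurely_iff_tendsto_real_not] at hP hQ
  refine almostSurely_of_eventually_real_not_le (by simpa using hP.add hQ) (.of_forall fun n => ?_)
  simp only [not_and_or]
  exact measureReal_union_le _ _

theorem almostSurely_eq_top_of_eq_one (p : ℕ → unitInterval) :
    AlmostSurely (fun n G => p n = 1 → G = ⊤) p :=
  almostSurely_imp_of_eventually_real_not_le tendsto_const_nhds <| .of_forall fun n hn => by
    simp [hn, measureReal_def, Measure.dirac_apply' _ MeasurableSet.of_discrete]

theorem tendsto_log_natCast : Tendsto (fun n : ℕ => Real.log n) atTop atTop :=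
  Real.tendsto_log_atTop.comp tendsto_natCast_atTop_atTop

theorem tendsto_log_natCast_div : Tendsto (fun n : ℕ => Real.log n / n) atTop (𝓝 0) :=
  Real.isLittleO_log_id_atTop.tendsto_div_nhds_zero.comp tendsto_natCast_atTop_atTop

theorem sq_div_four_le_choose_two {n : ℕ} (hn : 2 ≤ n) : (n : ℝ) ^ 2 / 4 ≤ n.choose 2 := by
  have hn' : (2 : ℝ) ≤ n := by exact_mod_cast hn
  rw [Nat.cast_choose_two]
  nlinarith

theorem choose_two_le_sq_div_two (n : ℕ) : (n.choose 2 : ℝ) ≤ (n : ℝ) ^ 2 / 2 := by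
  rw [Nat.cast_choose_two]
  nlinarith [n.cast_nonneg (α := ℝ)]

theorem almostSurely_abs_ncard_edgeSet_sub_lt (p : ℕ → unitInterval) :
    AlmostSurely
      (fun n G => |(G.edgeSet.ncard : ℝ) - n.choose 2 * p n| < n * Real.log n) p := by
  have htendsto : Tendsto (fun n : ℕ => 1 / Real.log n ^ 2) atTop (𝓝 0) :=
    tendsto_const_nhds.div_atTop ((tendsto_pow_atTop two_ne_zero).comp tendsto_log_natCast)
  refine almostSurely_of_eventually_real_not_le htendsto ?_
  filter_upwards [eventually_ge_atTop 1, tendsto_log_natCast.eventually_gt_atTop 0] with n hn hlog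
  have hn0 : (0 : ℝ) < n := by exact_mod_cast hn
  have hmean : (n.choose 2 : ℝ) * p n ≤ (n : ℝ) ^ 2 :=
    calc (n.choose 2 : ℝ) * p n ≤ n.choose 2 := mul_le_of_le_one_right (by positivity) (p n).2.2
      _ ≤ (n : ℝ) ^ 2 / 2 := choose_two_le_sq_div_two n
      _ ≤ (n : ℝ) ^ 2 := half_le_self (by positivity)
  simp only [not_lt]
  calc G(Fin n, p n).real {G | n * Real.log n ≤ |(G.edgeSet.ncard : ℝ) - n.choose 2 * p n|}
      ≤ n.choose 2 * p n / (n * Real.log n) ^ 2 := by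
        have h := binomialRandom_real_le_abs_ncard_edgeSet_sub (V := Fin n) (p n) (mul_pos hn0 hlog)
        rwa [Fintype.card_fin] at h
    _ ≤ (n : ℝ) ^ 2 / (n * Real.log n) ^ 2 := by gcongr
    _ = 1 / Real.log n ^ 2 := by field_simp

-- Here and in `almostSurely_not_connected` the condition on `p n` is imposed inside the property,
-- since a sequence may switch between the dense and the sparse regime infinitely often.
theorem almostSurely_connected (p : ℕ → unitInterval) :
    AlmostSurely (fun n G => 4 * (Real.log n / n) ≤ p n → G.Connected) p := by
  have htendsto : Tendsto (fun n : ℕ => Real.exp (n : ℝ)⁻¹ - 1) atTop (𝓝 0) := by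
    simpa using ((Real.continuous_exp.tendsto 0).comp
      (tendsto_inv_atTop_nhds_zero_nat (𝕜 := ℝ))).sub_const 1
  refine almostSurely_imp_of_eventually_real_not_le htendsto ?_
  filter_upwards [eventually_ge_atTop 1] with n hn hp
  have hn0 : (0 : ℝ) < n := by exact_mod_cast hn
  have : Nonempty (Fin n) := Fin.pos_iff_nonempty.1 hn
  have hcut : n * Real.exp (-(p n * n / 2)) ≤ (n : ℝ)⁻¹ :=
    calc n * Real.exp (-(p n * n / 2)) ≤ n * Real.exp (-(Real.log n + Real.log n)) := by
          rw [← mul_div_assoc, div_le_iff₀ hn0] at hp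
          gcongr
          linarith
      _ = (n : ℝ)⁻¹ := by
          rw [Real.exp_neg, Real.exp_add, Real.exp_log hn0]
          field_simp
  refine (binomialRandom_real_not_connected_le (p n)).trans ?_
  rw [Fintype.card_fin]
  gcongr

theorem exp_neg_two_mul_le_one_sub {x : ℝ} (hx0 : 0 ≤ x) (hx : x ≤ 1 / 2) :
    Real.exp (-(2 * x)) ≤ 1 - x := by
  have hx1 : 0 < 1 - x := by linarith
  rw [← Real.le_log_iff_exp_le hx1]
  calc -(2 * x) ≤ 1 - (1 - x)⁻¹ := by
        rw [le_sub_comm, inv_le_iff_one_le_mul₀ hx1]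
        nlinarith
    _ ≤ Real.log (1 - x) := Real.one_sub_inv_le_log_of_pos hx1

theorem inv_sqrt_le_one_sub_pow {n : ℕ} {x : ℝ} (hn : 0 < n) (hx0 : 0 ≤ x)
    (hx : x ≤ 1 / 4 * (Real.log n / n)) : (√n)⁻¹ ≤ (1 - x) ^ n := by
  have hn0 : (0 : ℝ) < n := by exact_mod_cast hn
  have hlog : Real.log n / n ≤ 1 := (div_le_one hn0).2 (Real.log_le_self hn0.le)
  calc (√n)⁻¹ = Real.exp (-(Real.log n / 2)) := by
        rw [Real.exp_neg, Real.exp_half, Real.exp_log hn0]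
    _ ≤ Real.exp (n * -(2 * x)) := by
        rw [← mul_div_assoc, le_div_iff₀ hn0] at hx
        rw [Real.exp_le_exp]
        linarith
    _ = Real.exp (-(2 * x)) ^ n := Real.exp_nat_mul _ n
    _ ≤ (1 - x) ^ n := by
        gcongr
        exact exp_neg_two_mul_le_one_sub hx0 (by linarith)

theorem almostSurely_not_connected (p : ℕ → unitInterval) :
    AlmostSurely (fun n G => p n ≤ 1 / 4 * (Real.log n / n) → ¬ G.Connected) p := by
  have htendsto : Tendsto (fun n : ℕ => (√n)⁻¹ + Real.log n / n) atTop (𝓝 0) := by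
    simpa using (tendsto_inv_atTop_zero.comp
      (Real.tendsto_sqrt_atTop.comp tendsto_natCast_atTop_atTop)).add tendsto_log_natCast_div
  refine almostSurely_imp_of_eventually_real_not_le htendsto ?_
  filter_upwards [eventually_ge_atTop 2] with n hn hp
  have hn0 : (0 : ℝ) < n := by positivity
  have : Nontrivial (Fin n) := Fin.nontrivial_iff_two_le.2 hn
  have hp0 : (0 : ℝ) ≤ p n := (p n).2.1
  have hlog : Real.log n / n ≤ 1 := (div_le_one hn0).2 (Real.log_le_self hn0.le)
  have hp1 : (0 : ℝ) < 1 - p n := by linarith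
  have hpow : (√n)⁻¹ ≤ (1 - p n : ℝ) ^ (n - 1) :=
    (inv_sqrt_le_one_sub_pow (by omega) hp0 hp).trans
      (pow_le_pow_of_le_one hp1.le (by linarith) (Nat.sub_le n 1))
  simp only [not_not]
  refine (binomialRandom_real_connected_le (p n) (by linarith)).trans (add_le_add ?_ ?_)
  · rw [Fintype.card_fin]
    calc 1 / (n * (1 - p n : ℝ) ^ (n - 1)) ≤ 1 / (n * (√n)⁻¹) := by gcongr
      _ = (√n)⁻¹ := by rw [← div_eq_mul_inv, Real.div_sqrt, one_div]
  · rw [div_le_iff₀ hp1]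
    nlinarith

end AlmostSurely

section Threshold

variable {f t : ℕ → ℝ}

theorem le_tmc_of_connected {n : ℕ} {x p : ℝ} {G : SimpleGraph (Fin n)} (hG : G.Connected)
    (hedges : |(G.edgeSet.ncard : ℝ) - n.choose 2 * p| < n * Real.log n) (hn : 2 ≤ n)
    (hlog : 1 ≤ Real.log n) (hx : 0 ≤ x) (hp : 16 * ((x + n * Real.log n) / n ^ 2) ≤ p) :
    x ≤ tmc G := by
  have htmc : (G.edgeSet.ncard : ℝ) + 2 ≤ tmc G + n := by
    exact_mod_cast Nat.card_fin n ▸ ncard_edgeSet_add_two_le_tmc_add_card hG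
  have hn_le : (n : ℝ) ≤ n * Real.log n := le_mul_of_one_le_right n.cast_nonneg hlog
  have hmean : 4 * (x + n * Real.log n) ≤ n.choose 2 * p :=
    calc 4 * (x + n * Real.log n)
        = (n : ℝ) ^ 2 / 4 * (16 * ((x + n * Real.log n) / n ^ 2)) := by
          field_simp
          ring
      _ ≤ n.choose 2 * p := by
          gcongr
          exact sq_div_four_le_choose_two hn
  linarith [(abs_lt.1 hedges).1]

theorem almostSurely_le_tmc {p : ℕ → unitInterval}
    (hf : ∀ᶠ n : ℕ in atTop, 0 ≤ f n ∧ f n ≤ n + n.choose 2)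
    (hp : ∀ᶠ n : ℕ in atTop, min 1 (16 * ((f n + n * Real.log n) / n ^ 2)) ≤ (p n : ℝ)) :
    AlmostSurely (fun n G => f n ≤ tmc G) p := by
  refine (((almostSurely_connected p).and (almostSurely_abs_ncard_edgeSet_sub_lt p)).and
    (almostSurely_eq_top_of_eq_one p)).mono ?_
  filter_upwards [hf, hp, eventually_ge_atTop 2, tendsto_log_natCast.eventually_ge_atTop 1]
    with n ⟨hf0, hf1⟩ hpn hn hlog G ⟨⟨hconn, hedges⟩, htop⟩
  have : (0 : ℝ) < n := by positivity
  rcases min_le_iff.1 hpn with hone | hlarge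
  · have : Nonempty (Fin n) := ⟨⟨0, by omega⟩⟩
    rw [htop (Subtype.ext (le_antisymm (p n).2.2 hone)), tmc_top, ncard_edgeSet_top, Nat.card_fin,
      Fintype.card_fin]
    exact_mod_cast hf1
  · refine le_tmc_of_connected (hconn (le_trans ?_ hlarge)) hedges hn hlog hf0 hlarge
    calc 4 * (Real.log n / n) = 4 * ((0 + n * Real.log n) / n ^ 2) := by field_simp; ring
      _ ≤ 16 * ((f n + n * Real.log n) / n ^ 2) := by
          gcongr
          norm_num

theorem tmc_lt_of_ncard_edgeSet_lt {n : ℕ} {x p : ℝ} {G : SimpleGraph (Fin n)}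
    (hedges : |(G.edgeSet.ncard : ℝ) - n.choose 2 * p| < n * Real.log n) (hn : 0 < n)
    (hlog : 1 ≤ Real.log n) (hp0 : 1 / 4 * (Real.log n / n) < p)
    (hp : p ≤ 1 / 20 * ((x + n * Real.log n) / n ^ 2)) : tmc G < x := by
  have hn0 : (0 : ℝ) < n := by exact_mod_cast hn
  have htmc : (tmc G : ℝ) ≤ n + G.edgeSet.ncard := by
    exact_mod_cast Nat.card_fin n ▸ tmc_le G
  have hn_le : (n : ℝ) ≤ n * Real.log n := le_mul_of_one_le_right n.cast_nonneg hlog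
  have hx : 4 * (n * Real.log n) < x := by
    have h := hp0.trans_le hp
    field_simp at h
    linarith
  have hmean : n.choose 2 * p ≤ (x + n * Real.log n) / 40 :=
    calc n.choose 2 * p ≤ (n : ℝ) ^ 2 / 2 * (1 / 20 * ((x + n * Real.log n) / n ^ 2)) := by
          gcongr
          · exact (by positivity : 0 ≤ 1 / 4 * (Real.log n / n)).trans hp0.le
          · exact choose_two_le_sq_div_two n
      _ = (x + n * Real.log n) / 40 := by
          field_simp
          ring
  linarith [(abs_lt.1 hedges).2]

theorem almostSurely_not_le_tmc {q : ℕ → unitInterval} (hf : ∀ᶠ n in atTop, 1 ≤ f n)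
    (hq : ∀ᶠ n : ℕ in atTop, (q n : ℝ) ≤ 1 / 20 * ((f n + n * Real.log n) / n ^ 2)) :
    AlmostSurely (fun n G => ¬ f n ≤ tmc G) q := by
  refine ((almostSurely_not_connected q).and (almostSurely_abs_ncard_edgeSet_sub_lt q)).mono ?_
  filter_upwards [hf, hq, eventually_gt_atTop 0, tendsto_log_natCast.eventually_ge_atTop 1]
    with n hfn hqn hn hlog G ⟨hconn, hedges⟩
  rw [not_le]
  rcases le_or_gt (q n : ℝ) (1 / 4 * (Real.log n / n)) with hsparse | hdense
  · rw [tmc_eq_zero_of_not_connected (hconn hsparse), Nat.cast_zero]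
    linarith
  · exact tmc_lt_of_ncard_edgeSet_lt hedges hn hlog hdense hqn

theorem exists_unitInterval_eventually_eq (h : ∀ᶠ n in atTop, t n ∈ unitInterval) :
    ∃ q : ℕ → unitInterval, ∀ᶠ n in atTop, (q n : ℝ) = t n := by
  refine ⟨fun n => Set.projIcc 0 1 zero_le_one (t n), ?_⟩
  filter_upwards [h] with n hn
  rw [Set.projIcc_of_mem zero_le_one hn]

theorem eventually_threshold_mem_Icc
    (hf : ∀ᶠ n : ℕ in atTop, 0 ≤ f n ∧ f n ≤ n + n.choose 2) :
    ∀ᶠ n : ℕ in atTop, (f n + n * Real.log n) / n ^ 2 ∈ Set.Icc 0 2 := by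
  filter_upwards [hf, eventually_ge_atTop 2] with n ⟨hf0, hf1⟩ hn
  have hn' : (2 : ℝ) ≤ n := by exact_mod_cast hn
  have hlog : Real.log n ≤ n - 1 := Real.log_le_sub_one_of_pos (by linarith)
  refine ⟨by positivity, ?_⟩
  rw [div_le_iff₀ (by positivity)]
  nlinarith [choose_two_le_sq_div_two n]

theorem isSharpThreshold_of_isTheta {P : ∀ n : ℕ, SimpleGraph (Fin n) → Prop} {g : ℕ → ℝ}
    {C c : ℝ} (hC : 0 < C) (hc : 0 < c) (ht : ∀ᶠ n in atTop, 0 ≤ t n)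
    (hg : ∀ᶠ n in atTop, 0 ≤ g n ∧ c * g n ≤ 1) (htg : t =Θ[atTop] g)
    (hupper : ∀ p : ℕ → unitInterval, (∀ᶠ n in atTop, min 1 (C * g n) ≤ (p n : ℝ)) →
      AlmostSurely P p)
    (hlower : ∀ q : ℕ → unitInterval, (∀ᶠ n in atTop, (q n : ℝ) ≤ c * g n) →
      AlmostSurely (fun n G => ¬ P n G) q) :
    IsSharpThreshold t P := by
  obtain ⟨B, hB, htB⟩ := htg.isBigO.exists_pos
  obtain ⟨A, hA, hgA⟩ := htg.isBigO_symm.exists_pos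
  refine ⟨C * A, c / B, by positivity, by positivity, fun p hp => hupper p ?_, ?_⟩
  · filter_upwards [hp, ht, hg, hgA.bound] with n hpn htn hgn hgAn
    rw [Real.norm_of_nonneg hgn.1, Real.norm_of_nonneg htn] at hgAn
    refine (min_le_min_left 1 ?_).trans hpn
    rw [mul_assoc]
    gcongr
  · have hle : ∀ᶠ n in atTop, c / B * t n ≤ c * g n := by
      filter_upwards [ht, hg, htB.bound] with n htn hgn htBn
      rw [Real.norm_of_nonneg hgn.1, Real.norm_of_nonneg htn, ← div_le_iff₀' hB] at htBn
      rw [div_mul_eq_mul_div, mul_div_assoc]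
      gcongr
    obtain ⟨q, hq⟩ := exists_unitInterval_eventually_eq (t := fun n => c / B * t n) <| by
      filter_upwards [ht, hg, hle] with n htn hgn hlen
      exact ⟨by positivity, hlen.trans hgn.2⟩
    refine ⟨q, hq, hlower q ?_⟩
    filter_upwards [hq, hle] with n hqn hlen
    rwa [hqn]

theorem eventually_nonneg_add_mul_log_log (hf : ∀ᶠ n in atTop, 0 ≤ f n) :
    ∀ᶠ n : ℕ in atTop, 0 ≤ (f n + n * Real.log (Real.log n)) / (n : ℝ) ^ 2 := by
  filter_upwards [hf, tendsto_log_natCast.eventually_ge_atTop 1] with n hfn hlog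
  have hloglog : 0 ≤ Real.log (Real.log n) := Real.log_nonneg hlog
  positivity

theorem isTheta_add_mul_log_log {l : ℝ} (hl : 0 < l)
    (hlf : ∀ᶠ n : ℕ in atTop, l * n * Real.log n ≤ f n) :
    (fun n : ℕ => (f n + n * Real.log (Real.log n)) / (n : ℝ) ^ 2) =Θ[atTop]
      fun n : ℕ => (f n + n * Real.log n) / (n : ℝ) ^ 2 := by
  refine IsTheta.div ⟨.of_bound 1 ?_, .of_bound (1 + l⁻¹) ?_⟩ isTheta_rfl
  all_goals
    filter_upwards [hlf, tendsto_log_natCast.eventually_ge_atTop 1] with n hfn hlog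
    have hloglog_nonneg : 0 ≤ Real.log (Real.log n) := Real.log_nonneg hlog
    have hloglog : Real.log (Real.log n) ≤ Real.log n := Real.log_le_self (by linarith)
    have hf0 : 0 ≤ f n := le_trans (by positivity) hfn
    rw [Real.norm_of_nonneg (by positivity), Real.norm_of_nonneg (by positivity)]
  · rw [one_mul]
    gcongr
  · have hdominated : n * Real.log n ≤ l⁻¹ * f n := by
      rwa [← div_eq_inv_mul, le_div_iff₀' hl, ← mul_assoc]
    calc f n + n * Real.log n ≤ (1 + l⁻¹) * f n := by linarith
      _ ≤ (1 + l⁻¹) * (f n + n * Real.log (Real.log n)) := by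
          gcongr
          exact le_add_of_nonneg_right (by positivity)

theorem isTheta_log_div (hf : f =o[atTop] fun n : ℕ => (n : ℝ) * Real.log n) :
    (fun n : ℕ => Real.log n / (n : ℝ)) =Θ[atTop]
      fun n : ℕ => (f n + n * Real.log n) / (n : ℝ) ^ 2 := by
  have h := hf.right_isTheta_add.div (isTheta_refl (fun n : ℕ => (n : ℝ) ^ 2) atTop)
  refine IsTheta.trans (EventuallyEq.isTheta ?_) h
  filter_upwards [eventually_gt_atTop 0] with n hn
  field_simp

end Threshold

end TMC

theorem theorem10_general {f t : ℕ → ℝ}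
    (hf : ∀ᶠ n : ℕ in atTop, 1 ≤ f n ∧ f n ≤ (1 / 2 : ℝ) * n * ((n : ℝ) - 1) + n)
    (ht : ∀ᶠ n in atTop, 0 ≤ t n)
    (htf : t =Θ[atTop] fun n : ℕ => (f n + n * Real.log n) / (n : ℝ) ^ 2) :
    TMC.IsSharpThreshold t (fun n G => f n ≤ (TMC.tmc G : ℝ)) := by
  have hf' : ∀ᶠ n : ℕ in atTop, 0 ≤ f n ∧ f n ≤ n + n.choose 2 := by
    filter_upwards [hf] with n ⟨hf1, hf2⟩
    rw [Nat.cast_choose_two]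
    constructor <;> linarith
  refine TMC.isSharpThreshold_of_isTheta (by norm_num : (0 : ℝ) < 16)
    (by norm_num : (0 : ℝ) < 1 / 20) ht ?_ htf (fun p => TMC.almostSurely_le_tmc hf')
    fun q => TMC.almostSurely_not_le_tmc (hf.mono fun n h => h.1)
  filter_upwards [TMC.eventually_threshold_mem_Icc hf'] with n ⟨h0, h2⟩
  exact ⟨h0, by linarith⟩

theorem theorem10 (f : ℕ → ℝ)
    (hf : ∀ᶠ n : ℕ in atTop, 1 ≤ f n ∧ f n < (1 / 2 : ℝ) * n * ((n : ℝ) - 1) + n) :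
    (∀ l : ℝ, 0 < l → (∀ᶠ n : ℕ in atTop, l * n * Real.log n ≤ f n) →
      TMC.IsSharpThreshold
        (fun n : ℕ => (f n + n * Real.log (Real.log n)) / (n : ℝ) ^ 2)
        (fun n G => f n ≤ (TMC.tmc G : ℝ))) ∧
    ((f =o[atTop] fun n : ℕ => (n : ℝ) * Real.log n) →
      TMC.IsSharpThreshold
        (fun n : ℕ => Real.log n / (n : ℝ))
        (fun n G => f n ≤ (TMC.tmc G : ℝ))) := by
  have hf' := hf.mono fun n h => And.intro h.1 h.2.le
  exact ⟨fun l hl hlf => theorem10_general hf' (TMC.eventually_nonneg_add_mul_log_log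
      (hf.mono fun n h => zero_le_one.trans h.1)) (TMC.isTheta_add_mul_log_log hl hlf),
    fun hfo => theorem10_general hf' (.of_forall fun n => by positivity)
      (TMC.isTheta_log_div hfo)⟩
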